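/- Let $T$ be a complete first-order theory in a language $L$, and write $|T|=|L|+\aleph_0$. Let $\mathfrak C\models T$ be a monster model: $\mathfrak C$ is $\bar\kappa$-saturated for a cardinal $\bar\kappa>|T|^+$. A set or cardinal is called small if it has size $<\bar\kappa$. Let $A\subseteq\mathfrak C$ be small and let $p(x)$ be a consistent partial type over $A$ in a finite tuple of variables $x$. Definitions. Infinite sequences $(I_i)_{i<\mu}$, each indexed by an infinite linear order and consisting of tuples of $\mathfrak C$, are mutually indiscernible over $A$ if each $I_i$ is indiscernible over $A\cup\bigcup_{j\neq i}I_j$. For a cardinal $\mu$ we write $\mathrm{dp\text{-}rk}(p)<\mu$ if, for every realization $a$ of $p$ and every $\mu$ sequences mutually indiscernible over $A$, at least one of them is indiscernible over $Aa$; and $\mathrm{dp\text{-}rk}(p)\ge\mu$ means that this fails. The type $p$ is dependent if $\mathrm{dp\text{-}rk}(p)<\mu$ for some small cardinal $\mu$, and independent if this holds for no small cardinal $\mu$ (that is, $\mathrm{dp\text{-}rk}(p)=\infty$). For $B\subseteq A$, $p|_B$ is the set of formulas of $p$ with parameters in $B$, and its dp-rank is computed over $B$. Then: (1) If $p$ is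 dependent, then there is $B\subseteq A$ with $|B|\le|T|$ such that $p|_B$ is dependent. (2) $p$ is independent if and only if $\mathrm{dp\text{-}rk}(p)\ge|T|^+$. -/

import Mathlib

open FirstOrder Cardinal

universe u v w t

namespace DpRank

/-- The cardinal `|T|` of a first-order theory in the language `L`: the number of `L`-formulas,
i.e. `|L| + ℵ₀`. -/
noncomputable def cardT (L : FirstOrder.Language.{u, v}) : Cardinal.{max u v} :=
  max ℵ₀ L.card

section

variable (L : FirstOrder.Language.{u, v}) {C : Type w} [L.Structure C]

/-- A partial type in the finite tuple of variables `x = (x₀, …, xₙ₋₁)` over the set `A`: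
a set of formulas in `x` with parameters in `A`. Consistency is a separate predicate. -/
abbrev PartialType (A : Set C) (n : ℕ) : Type (max u v w) :=
  Set (L[[A]].Formula (Fin n))

variable {L}

/-- The tuple `a` realizes the partial type `p`. -/
def Realizes {A : Set C} {n : ℕ} (a : Fin n → C) (p : PartialType L A n) : Prop :=
  ∀ φ ∈ p, φ.Realize a

/-- A partial type over `A` is consistent (with the elementary diagram of `A` in `C`) if each of
its finite subsets is satisfied by some tuple of `C`. -/
def IsConsistent {A : Set C} {n : ℕ} (p : PartialType L A n) : Prop :=
  ∀ q : Finset (L[[A]].Formula (Fin n)), (q : Set (L[[A]].Formula (Fin n))) ⊆ p →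
    ∃ a : Fin n → C, Realizes (L := L) a (q : Set (L[[A]].Formula (Fin n)))

/-- The restriction `p|_B`, for `B ⊆ A`: the formulas of `p` all of whose parameters lie in `B`. -/
def PartialType.restrict {A : Set C} {n : ℕ} (p : PartialType L A n) {B : Set C} (h : B ⊆ A) :
    PartialType L B n :=
  {φ | (L.lhomWithConstantsMap (Set.inclusion h)).onFormula φ ∈ p}

variable (L) (C) in
/-- `C` is `κ`-saturated: every consistent partial type in finitely many variables over a set of
fewer than `κ` parameters is realized in `C`. -/
def IsSaturated (κ : Cardinal.{w}) : Prop :=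
  ∀ A : Set C, #A < κ → ∀ (n : ℕ) (p : PartialType L A n), IsConsistent p →
    ∃ a : Fin n → C, Realizes a p

variable (L) in
/-- The sequence `I` of `β`-tuples, indexed by a linear order `J`, is indiscernible over `B`: any
two increasing finite subsequences of the same length satisfy the same formulas over `B`. -/
def Indiscernible {J β : Type w} [LinearOrder J] (B : Set C) (I : J → β → C) : Prop :=
  ∀ (m : ℕ) (φ : L[[B]].Formula (Fin m × β)) (s r : Fin m → J), StrictMono s → StrictMono r →
    (φ.Realize (fun z => I (s z.1) z.2) ↔ φ.Realize (fun z => I (r z.1) z.2))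

/-- The set of all elements of `C` that occur in some tuple of the sequence `I`. -/
def support {J β : Type w} (I : J → β → C) : Set C :=
  {c | ∃ j b, I j b = c}

variable (L) in
/-- The sequences `I i` are mutually indiscernible over `A`: each is indiscernible over `A`
together with all the other sequences. -/
def MutuallyIndiscernible {ι : Type t} {J β : ι → Type w} [∀ i, LinearOrder (J i)]
    (A : Set C) (I : ∀ i, J i → β i → C) : Prop :=
  ∀ i, Indiscernible L (A ∪ ⋃ k ∈ {k : ι | k ≠ i}, support (I k)) (I i)

/-- `dp-rk(p) < κ`: for every realization `a` of `p` and any `κ` infinite sequences (of tuples of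
arbitrary length) that are mutually indiscernible over `A`, at least one of them is indiscernible
over `Aa`. -/
def DpRankLT {A : Set C} {n : ℕ} (p : PartialType L A n) (κ : Cardinal.{t}) : Prop :=
  ∀ a : Fin n → C, Realizes a p →
    ∀ (ι : Type t) (J β : ι → Type w) [∀ i, LinearOrder (J i)] [∀ i, Infinite (J i)]
      (I : ∀ i, J i → β i → C), #ι = κ → MutuallyIndiscernible L A I →
        ∃ i, Indiscernible L (A ∪ Set.range a) (I i)

/-- `dp-rk(p) ≥ κ`. -/
def DpRankGE {A : Set C} {n : ℕ} (p : PartialType L A n) (κ : Cardinal.{t}) : Prop :=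
  ¬ DpRankLT p κ

/-- `p` is dependent, i.e. `dp-rk(p) < ∞`: one has `dp-rk(p) < μ` for some cardinal `μ`. As always
inside a monster model, which is `κ`-saturated for a large cardinal `κ`, cardinals range over the
small ones, those below `κ`. -/
def IsDependent (κ : Cardinal.{w}) {A : Set C} {n : ℕ} (p : PartialType L A n) : Prop :=
  ∃ μ : Cardinal.{w}, μ < κ ∧ DpRankLT p μ

/-- `p` is independent, i.e. `dp-rk(p) = ∞`: `dp-rk(p) < μ` holds for no (small) cardinal `μ`. -/
def IsIndependent (κ : Cardinal.{w}) {A : Set C} {n : ℕ} (p : PartialType L A n) : Prop :=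
  ∀ μ : Cardinal.{w}, μ < κ → ¬ DpRankLT p μ

end

end DpRank

/-!
The dp-rank of `p` is at least `μ` when some realization `a` of `p` breaks the indiscernibility of
every member of some mutually indiscernible family of size `μ`. Breaking is always due to
one formula and two finite increasing subsequences of an infinite order; a `Pattern` records these
data up to isomorphism, in the following normal form.

* Finitely many indices matter, and an infinite linear order contains a copy of `ω` or of its
  reverse, so the index order may be shrunk to such a ray with finitely many points added on either
  side (`exists_shape_strictMono`).
* Finitely many coordinates of the tuples and finitely many parameters from `A` matter. The
  parameters are moved into the tuples, which does not affect mutual indiscernibility over `A`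
  (`IndiscOver.reindex`). What remains is a formula of `L` without parameters.

Thus there are at most `|T|` patterns (`mk_pattern_le`). Among `|T|⁺` sequences witnessing
`dp-rk(p) ≥ |T|⁺`, infinitely many show the same pattern (`exists_isPattern_of_not_dpRankLT`).
Conversely, a pattern shown by infinitely many mutually indiscernible sequences is shown by `μ` many
for each small `μ`, by compactness: a finite part of the requirements on `μ` sequences concerns only
finitely many of them, and only finitely many elements of `A` (`exists_isPattern`). Saturation is
needed here for types in infinitely many variables (`IsSaturated.exists_realize`). This proves
that `p` is independent if and only if its dp-rank is at least `|T|⁺`.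

If `p` is dependent, then no pattern occurs, and by the same compactness argument every pattern `P`
is already excluded by the restriction of `p` to some finite `A₀ P ⊆ A`. The union of the sets
`A₀ P` has size at most `|T|`, and no pattern occurs over it.
-/

universe s

namespace DpRank

open FirstOrder.Language

variable {L : FirstOrder.Language.{u, v}} {C : Type w}

/-! ### Formulas with parameters use finitely many parameters -/

theorem exists_finset_onTerm_eq {A : Set C} {α : Type*} (τ : L[[A]].Term α) :
    ∃ s : Finset A, ∀ (B : Set C) (hB : B ⊆ A), (∀ x ∈ s, (x : C) ∈ B) →
      ∃ τ' : L[[B]].Term α, (L.lhomWithConstantsMap (Set.inclusion hB)).onTerm τ' = τ := by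
  classical
  induction τ with
  | var x => exact ⟨∅, fun B hB _ => ⟨.var x, rfl⟩⟩
  | @func l f ts ih =>
    choose s hs using ih
    have hf : ∃ s' : Finset A, ∀ (B : Set C) (hB : B ⊆ A), (∀ x ∈ s', (x : C) ∈ B) →
        ∃ f' : L[[B]].Functions l,
          (L.lhomWithConstantsMap (Set.inclusion hB)).onFunction f' = f := by
      obtain f | f := f
      · exact ⟨∅, fun B hB _ => ⟨.inl f, rfl⟩⟩
      · match l, f with
        | 0, c =>
          exact ⟨{(c : A)}, fun B hB h =>
            ⟨.inr ⟨(c : A), h _ (Finset.mem_singleton_self _)⟩, rfl⟩⟩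
    obtain ⟨s', hs'⟩ := hf
    refine ⟨s' ∪ Finset.univ.biUnion s, fun B hB h => ?_⟩
    obtain ⟨f', hf'⟩ := hs' B hB fun x hx => h x (by simp [hx])
    choose ts' hts' using fun i => hs i B hB fun x hx => h x (by simp; exact Or.inr ⟨i, hx⟩)
    exact ⟨.func f' ts', by simp only [LHom.onTerm, hf', hts']⟩

/-- Equality of formulas, rather than equivalence, is needed, as it is what membership in the
restriction of a partial type refers to. -/
theorem exists_finset_onBoundedFormula_eq {A : Set C} {α : Type*} {k : ℕ}
    (φ : L[[A]].BoundedFormula α k) :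
    ∃ s : Finset A, ∀ (B : Set C) (hB : B ⊆ A), (∀ x ∈ s, (x : C) ∈ B) →
      ∃ φ' : L[[B]].BoundedFormula α k,
        (L.lhomWithConstantsMap (Set.inclusion hB)).onBoundedFormula φ' = φ := by
  classical
  induction φ with
  | falsum => exact ⟨∅, fun B hB _ => ⟨.falsum, rfl⟩⟩
  | equal t₁ t₂ =>
    obtain ⟨s₁, h₁⟩ := exists_finset_onTerm_eq t₁
    obtain ⟨s₂, h₂⟩ := exists_finset_onTerm_eq t₂
    refine ⟨s₁ ∪ s₂, fun B hB h => ?_⟩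
    obtain ⟨t₁', rfl⟩ := h₁ B hB fun x hx => h x (by simp [hx])
    obtain ⟨t₂', rfl⟩ := h₂ B hB fun x hx => h x (by simp [hx])
    exact ⟨.equal t₁' t₂', rfl⟩
  | @rel n l R ts =>
    choose s hs using fun i => exists_finset_onTerm_eq (ts i)
    refine ⟨Finset.univ.biUnion s, fun B hB h => ?_⟩
    choose ts' hts' using fun i => hs i B hB fun x hx => h x (by simp; exact ⟨i, hx⟩)
    obtain R | R := R
    · refine ⟨.rel (.inl R) ts', ?_⟩
      rw [← funext hts']
      rfl
    · exact isEmptyElim R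
  | imp _ _ ih₁ ih₂ =>
    obtain ⟨s₁, h₁⟩ := ih₁
    obtain ⟨s₂, h₂⟩ := ih₂
    refine ⟨s₁ ∪ s₂, fun B hB h => ?_⟩
    obtain ⟨t₁', rfl⟩ := h₁ B hB fun x hx => h x (by simp [hx])
    obtain ⟨t₂', rfl⟩ := h₂ B hB fun x hx => h x (by simp [hx])
    exact ⟨.imp t₁' t₂', rfl⟩
  | all _ ih =>
    obtain ⟨s, hs⟩ := ih
    refine ⟨s, fun B hB h => ?_⟩
    obtain ⟨φ', rfl⟩ := hs B hB h
    exact ⟨.all φ', rfl⟩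

variable [L.Structure C]

/-! ### Indiscernibility over a family of parameters -/

variable (L) in
/-- The sequence `I` is indiscernible over the family of parameters `e`. Formulas of `L` are used,
with variables for the parameters in place of constants, so that the parameters can be varied. -/
def IndiscOver {W J β : Type*} [LinearOrder J] (e : W → C) (I : J → β → C) : Prop :=
  ∀ (m : ℕ) (φ : L.Formula (W ⊕ Fin m × β)) (s r : Fin m → J), StrictMono s → StrictMono r →
    (φ.Realize (Sum.elim e fun z => I (s z.1) z.2) ↔
      φ.Realize (Sum.elim e fun z => I (r z.1) z.2))

theorem realize_constantsVarsEquiv_formula {A : Set C} {α : Type*} (φ : L[[A]].Formula α)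
    (v : α → C) :
    Formula.Realize (L := L) (BoundedFormula.constantsVarsEquiv φ) (Sum.elim Subtype.val v) ↔
      φ.Realize v :=
  BoundedFormula.realize_constantsVarsEquiv (φ := φ)

theorem indiscernible_iff_indiscOver {J β : Type w} [LinearOrder J] {B : Set C}
    {I : J → β → C} :
    Indiscernible L B I ↔ IndiscOver L (Subtype.val : B → C) I := by
  refine forall_congr' fun m => ⟨fun h φ s r hs hr => ?_, fun h φ s r hs hr => ?_⟩
  · obtain ⟨φ, rfl⟩ := BoundedFormula.constantsVarsEquiv.surjective φ
    exact (realize_constantsVarsEquiv_formula φ _).trans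
      ((h φ s r hs hr).trans (realize_constantsVarsEquiv_formula φ _).symm)
  · exact (realize_constantsVarsEquiv_formula φ _).symm.trans
      ((h _ s r hs hr).trans (realize_constantsVarsEquiv_formula φ _))

/-- Indiscernibility over `e` depends on the range of `e` only and passes to smaller ranges. -/
theorem IndiscOver.of_forall_exists_eq {W W' J β : Type*} [LinearOrder J] {e : W → C}
    {e' : W' → C} {I : J → β → C} (h : IndiscOver L e I) (hr : ∀ w', ∃ w, e w = e' w') :
    IndiscOver L e' I := by
  choose g hg using hr
  intro m φ s r hs hr
  have h' := h m (φ.relabel (Sum.map g id)) s r hs hr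
  simp only [Formula.realize_relabel, Sum.elim_comp_map, Function.comp_id] at h'
  rwa [show e ∘ g = e' from funext hg] at h'

theorem IndiscOver.of_finset {W J β : Type*} [LinearOrder J] {e : W → C} {I : J → β → C}
    (h : ∀ t : Finset W, IndiscOver L (fun w : t => e w) I) : IndiscOver L e I := by
  classical
  intro m φ s r hs hr
  let t : Finset W := φ.freeVarFinset.toLeft
  let f : φ.freeVarFinset → t ⊕ Fin m × β := fun x => match x with
    | ⟨.inl w, hw⟩ => .inl ⟨w, Finset.mem_toLeft.2 hw⟩
    | ⟨.inr z, _⟩ => .inr z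
  have key : ∀ y : Fin m × β → C,
      Formula.Realize (BoundedFormula.restrictFreeVar φ f) (Sum.elim (fun w : t => e w) y) ↔
        φ.Realize (Sum.elim e y) := fun y =>
    BoundedFormula.realize_restrictFreeVar _ (by rintro ⟨_ | _, _⟩ <;> rfl)
  rw [← key, ← key]
  exact h t m _ s r hs hr

/-- Each new tuple is obtained from the old one by selecting coordinates and inserting
parameters, and the index order is shrunk. -/
theorem IndiscOver.reindex {W J J' β β' : Type*} [LinearOrder J] [LinearOrder J'] {e : W → C}
    {I : J → β → C} (h : IndiscOver L e I) {F : J' → J} (hF : StrictMono F) (t : β' → W ⊕ β) :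
    IndiscOver L e (fun z b => Sum.elim e (I (F z)) (t b)) := by
  intro m φ s r hs hr
  have h' := h m (φ.relabel (Sum.elim Sum.inl fun z => (t z.2).map id (Prod.mk z.1)))
    (F ∘ s) (F ∘ r) (hF.comp hs) (hF.comp hr)
  simp only [Formula.realize_relabel] at h'
  have key : ∀ q : Fin m → J', (Sum.elim e (fun z : Fin m × β => I ((F ∘ q) z.1) z.2) ∘
      Sum.elim Sum.inl fun z : Fin m × β' => (t z.2).map id (Prod.mk z.1)) =
      Sum.elim e fun z : Fin m × β' => Sum.elim e (I (F (q z.1))) (t z.2) := by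
    intro q
    funext x
    obtain w | ⟨i, b⟩ := x
    · rfl
    · simp only [Function.comp_apply, Sum.elim_inr]
      cases t b <;> rfl
  rwa [key, key] at h'

/-! ### Saturation for types in infinitely many variables -/

/-- Unlike in `Set.Definable.image_comp`, the set of variables may be infinite. -/
theorem definable_image_eval [Nonempty C] {U : Type*} {B : Set C} {X : Set (U → C)}
    (hX : B.Definable L X) (u : U) :
    B.Definable L ((fun (v : U → C) (_ : Fin 1) => v u) '' X) := by
  classical
  obtain ⟨φ, rfl⟩ := hX
  let t : Set U := insert u (φ.freeVarFinset : Set U)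
  have ht : (φ.freeVarFinset : Set U) ⊆ t := Set.subset_insert _ _
  have : Finite t := (φ.freeVarFinset.finite_toSet.insert u).to_subtype
  have hY : B.Definable L {w : t → C |
      Formula.Realize (BoundedFormula.restrictFreeVar φ (Set.inclusion ht)) w} :=
    ⟨(BoundedFormula.restrictFreeVar φ (Set.inclusion ht) : L[[B]].Formula t), rfl⟩
  have hu : u ∈ t := Set.mem_insert _ _
  convert hY.image_comp (fun _ : Fin 1 => (⟨u, hu⟩ : t)) using 1
  ext y
  constructor
  · rintro ⟨v, hv, rfl⟩
    exact ⟨v ∘ (↑), (BoundedFormula.realize_restrictFreeVar' ht).2 hv, rfl⟩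
  · rintro ⟨w, hw, rfl⟩
    let v : U → C := fun x => if hx : x ∈ t then w ⟨x, hx⟩ else Classical.arbitrary C
    have hv : v ∘ ((↑) : t → U) = w := by
      funext x
      simp only [Function.comp_apply, v, dif_pos x.2]
    refine ⟨v, ?_, ?_⟩
    · exact (BoundedFormula.realize_restrictFreeVar' ht).1 (by rw [hv]; exact hw)
    · funext i
      exact congrFun hv ⟨u, hu⟩

/-- Saturation in the language of definable sets. -/
theorem IsSaturated.exists_forall_mem {κ : Cardinal.{w}} (hsat : IsSaturated L C κ) {B : Set C}
    (hB : #B < κ) {n : ℕ} (𝒳 : Set (Set (Fin n → C))) (hdef : ∀ X ∈ 𝒳, B.Definable L X)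
    (hfip : ∀ F : Finset (Set (Fin n → C)), (F : Set (Set (Fin n → C))) ⊆ 𝒳 →
      ∃ y, ∀ X ∈ F, y ∈ X) :
    ∃ y, ∀ X ∈ 𝒳, y ∈ X := by
  classical
  obtain ⟨a, ha⟩ := hsat B hB n {φ | Set.ofPred φ.Realize ∈ 𝒳} fun q hq => by
    obtain ⟨y, hy⟩ := hfip (q.image fun φ => Set.ofPred φ.Realize) (by
      intro X hX
      obtain ⟨φ, hφ, rfl⟩ := Finset.mem_image.1 (Finset.mem_coe.1 hX)
      exact hq hφ)
    exact ⟨y, fun φ hφ => hy _ (Finset.mem_image_of_mem _ hφ)⟩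
  refine ⟨a, fun X hX => ?_⟩
  obtain ⟨φ, rfl⟩ := hdef X hX
  exact ha φ hX

/-- In a `κ`-saturated structure, a set `Γ` of formulas in fewer than `κ` variables can be realized
with prescribed values at the variables in `S`, if each finite subset of `Γ` can. The variables in
`S` play the role of parameters. -/
theorem IsSaturated.exists_realize [Nonempty C] {κ : Cardinal.{w}} (hsat : IsSaturated L C κ)
    {U : Type w} (hU : #U < κ) (Γ : Set (L.Formula U)) (S : Set U) (f : U → C)
    (hΓ : ∀ Γ₀ : Finset (L.Formula U), (Γ₀ : Set (L.Formula U)) ⊆ Γ →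
      ∃ v : U → C, (∀ x ∈ S, v x = f x) ∧ ∀ φ ∈ Γ₀, φ.Realize v) :
    ∃ v : U → C, (∀ x ∈ S, v x = f x) ∧ ∀ φ ∈ Γ, φ.Realize v := by
  classical
  -- the graphs of the partial assignments that are compatible with `Γ`
  let Good (G : Set (U × C)) : Prop := ∀ (G₀ : Finset (U × C)) (Γ₀ : Finset (L.Formula U)),
    (G₀ : Set (U × C)) ⊆ G → (Γ₀ : Set (L.Formula U)) ⊆ Γ →
      ∃ v : U → C, (∀ x ∈ G₀, v x.1 = x.2) ∧ ∀ φ ∈ Γ₀, φ.Realize v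
  have hfin : Order.IsOfFiniteCharacter {G | Good G} := by
    refine fun G => ⟨fun hG G' hG' _ G₀ Γ₀ h₀ => hG G₀ Γ₀ (h₀.trans hG'),
      fun hG G₀ Γ₀ h₀ => hG G₀ h₀ G₀.finite_toSet G₀ Γ₀ subset_rfl⟩
  have hbase : Good ((fun x => (x, f x)) '' S) := by
    intro G₀ Γ₀ h₀ h₁
    obtain ⟨v, hv, hv'⟩ := hΓ Γ₀ h₁
    refine ⟨v, fun x hx => ?_, hv'⟩
    obtain ⟨y, hy, rfl⟩ := h₀ hx
    exact hv y hy
  obtain ⟨G, hSG, hGmax⟩ := hfin.exists_maximal hbase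
  have hG : Good G := hGmax.prop
  have hfun : ∀ x ∈ G, ∀ y ∈ G, x.1 = y.1 → x = y := by
    intro x hx y hy hxy
    obtain ⟨v, hv, -⟩ := hG {x, y} ∅ (by simp [Set.insert_subset_iff, hx, hy]) (by simp)
    have h1 := hv x (by simp)
    have h2 := hv y (by simp)
    exact Prod.ext hxy (by rw [← h1, ← h2, hxy])
  have htot : ∀ u, ∃ c, (u, c) ∈ G := by
    intro u
    -- The possible values at `u` form a type over the values assigned so far.
    let B : Set C := Prod.snd '' G
    have hB : #B < κ := by
      refine lt_of_le_of_lt (mk_image_le.trans ?_) hU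
      exact mk_le_of_injective (f := fun x : G => x.1.1) fun x y hxy =>
        Subtype.ext (hfun _ x.2 _ y.2 hxy)
    let X (G₀ : Finset (U × C)) (Γ₀ : Finset (L.Formula U)) : Set (U → C) :=
      {v | (∀ x ∈ G₀, v x.1 = x.2) ∧ ∀ φ ∈ Γ₀, φ.Realize v}
    have hXdef : ∀ (G₀ : Finset (U × C)) Γ₀, (G₀ : Set (U × C)) ⊆ G → B.Definable L (X G₀ Γ₀) := by
      intro G₀ Γ₀ h₀
      have h1 : B.Definable L (⋂ x : G₀, {v : U → C | v x.1.1 = x.1.2}) := by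
        refine Set.definable_iInter_of_finite fun x => ?_
        refine ⟨Term.equal (Term.var x.1.1) (L.con
          (⟨x.1.2, Set.mem_image_of_mem _ (h₀ x.2)⟩ : B)).term, ?_⟩
        ext v
        simp [Formula.realize_equal]
      have h2 : B.Definable L (⋂ φ : Γ₀, {v : U → C | φ.1.Realize v}) :=
        Set.definable_iInter_of_finite fun φ =>
          (Set.empty_definable_iff.2 ⟨φ.1, rfl⟩).mono (Set.empty_subset _)
      convert h1.inter h2 using 1
      ext v
      simp [X]
    obtain ⟨y, hy⟩ := hsat.exists_forall_mem hB
      {Y | ∃ (G₀ : Finset (U × C)) (Γ₀ : Finset (L.Formula U)), (G₀ : Set (U × C)) ⊆ G ∧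
        (Γ₀ : Set (L.Formula U)) ⊆ Γ ∧
        Y = (fun (v : U → C) (_ : Fin 1) => v u) '' X G₀ Γ₀}
      (by
        rintro _ ⟨G₀, Γ₀, h₀, -, rfl⟩
        exact definable_image_eval (hXdef G₀ Γ₀ h₀) u)
      (by
        intro F hF
        choose! g γ hg hγ hF using hF
        obtain ⟨v, hv, hv'⟩ := hG (F.biUnion g) (F.biUnion γ)
          (by
            simp only [Finset.coe_biUnion, Set.iUnion_subset_iff]
            exact fun Y hY => hg hY)
          (by
            simp only [Finset.coe_biUnion, Set.iUnion_subset_iff]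
            exact fun Y hY => hγ hY)
        refine ⟨fun _ => v u, fun Y hY => ?_⟩
        rw [hF hY]
        exact ⟨v, ⟨fun x hx => hv x (Finset.mem_biUnion.2 ⟨Y, hY, hx⟩),
          fun φ hφ => hv' φ (Finset.mem_biUnion.2 ⟨Y, hY, hφ⟩)⟩, rfl⟩)
    refine ⟨y 0, ?_⟩
    have hgood : Good (insert (u, y 0) G) := by
      intro G₀ Γ₀ h₀ h₁
      obtain ⟨v, ⟨hv, hv'⟩, hvy⟩ := hy _ ⟨G₀.erase (u, y 0), Γ₀, by
        intro x hx
        have hx := Finset.mem_erase.1 (Finset.mem_coe.1 hx)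
        exact (h₀ hx.2).resolve_left hx.1, h₁, rfl⟩
      refine ⟨v, fun x hx => ?_, hv'⟩
      by_cases hxu : x = (u, y 0)
      · rw [hxu, ← hvy]
      · exact hv x (Finset.mem_erase.2 ⟨hxu, hx⟩)
    exact hGmax.le_of_ge hgood (Set.subset_insert _ _) (Set.mem_insert _ _)
  choose v hv using htot
  refine ⟨v, fun x hx => ?_, fun φ hφ => ?_⟩
  · exact congrArg Prod.snd (hfun _ (hv x) _ (hSG ⟨x, hx, rfl⟩) rfl)
  · obtain ⟨v', hv', hφ'⟩ := hG (φ.freeVarFinset.image fun x => (x, v x)) {φ}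
      (by
        intro x hx
        obtain ⟨y, -, rfl⟩ := Finset.mem_image.1 (Finset.mem_coe.1 hx)
        exact hv y) (by simpa using hφ)
    have h1 := hφ' φ (by simp)
    -- the truth value of `φ` depends on its free variables only
    have h2 := (BoundedFormula.realize_restrictFreeVar (φ := φ) (f := (↑)) (v := v) (xs := default)
      v' fun a => (hv' _ (Finset.mem_image_of_mem _ a.2)).symm).2 h1
    exact (BoundedFormula.realize_restrictFreeVar (φ := φ) (f := (↑)) (v := v) (xs := default)
      v fun a => rfl).1 h2

/-! ### Rays in infinite linear orders -/

/-- The order `ω` or its reverse. -/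
def Ray : Bool → Type
  | true => ℕ
  | false => ℕᵒᵈ

instance : ∀ d, LinearOrder (Ray d)
  | true => inferInstanceAs (LinearOrder ℕ)
  | false => inferInstanceAs (LinearOrder ℕᵒᵈ)

instance : ∀ d, Infinite (Ray d)
  | true => inferInstanceAs (Infinite ℕ)
  | false => inferInstanceAs (Infinite ℕᵒᵈ)

instance : ∀ d, Countable (Ray d)
  | true => inferInstanceAs (Countable ℕ)
  | false => inferInstanceAs (Countable ℕᵒᵈ)

/-- A ray with finitely many points added at either side. -/
abbrev Shape (d : Bool) (g h : ℕ) : Type :=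
  Fin g ⊕ₗ (Ray d ⊕ₗ Fin h)

instance (d : Bool) (g h : ℕ) : Infinite (Shape d g h) :=
  Infinite.of_injective (fun x : Ray d => toLex (Sum.inr (toLex (Sum.inl x)))) fun x y hxy => by
    simpa using hxy

instance (d : Bool) (g h : ℕ) : Countable (Shape d g h) :=
  inferInstanceAs (Countable (Fin g ⊕ (Ray d ⊕ Fin h)))

/-- A tail of a monotone sequence in `J` stays on one side of each point of the finite set `s`. -/
theorem exists_ray_strictMono {J : Type*} [LinearOrder J] [Infinite J] (s : Finset J) :
    ∃ (d : Bool) (f : Ray d → J), StrictMono f ∧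
      ∀ x ∈ s, (∀ k, x < f k) ∨ ∀ k, f k < x := by
  classical
  obtain ⟨f, hf | hf⟩ := Infinite.exists_strictMono_or_strictAnti J
  · have : ∀ x : J, ∃ N : ℕ, (∀ k, N ≤ k → x < f k) ∨ ∀ k, N ≤ k → f k < x := by
      intro x
      by_cases h : ∃ N, x < f N
      · obtain ⟨N, hN⟩ := h
        exact ⟨N, Or.inl fun k hk => hN.trans_le (hf.monotone hk)⟩
      · push Not at h
        exact ⟨0, Or.inr fun k _ => (hf k.lt_succ_self).trans_le (h _)⟩
    choose N hN using this
    refine ⟨true, fun k : ℕ => f (s.sup N + k), fun a b hab => hf (Nat.add_lt_add_left hab _),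
      fun x hx => ?_⟩
    have hle : N x ≤ s.sup N := Finset.le_sup hx
    exact (hN x).imp (fun h k => h _ (hle.trans (Nat.le_add_right _ _)))
      fun h k => h _ (hle.trans (Nat.le_add_right _ _))
  · have : ∀ x : J, ∃ N : ℕ, (∀ k, N ≤ k → x < f k) ∨ ∀ k, N ≤ k → f k < x := by
      intro x
      by_cases h : ∃ N, f N < x
      · obtain ⟨N, hN⟩ := h
        exact ⟨N, Or.inr fun k hk => (hf.antitone hk).trans_lt hN⟩
      · push Not at h
        exact ⟨0, Or.inl fun k _ => (h _).trans_lt (hf k.lt_succ_self)⟩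
    choose N hN using this
    refine ⟨false, fun k : ℕᵒᵈ => f (s.sup N + OrderDual.ofDual k),
      fun a b hab => hf (Nat.add_lt_add_left (OrderDual.ofDual_lt_ofDual.2 hab) _),
      fun x hx => ?_⟩
    have hle : N x ≤ s.sup N := Finset.le_sup hx
    exact (hN x).imp (fun h k => h _ (hle.trans (Nat.le_add_right _ _)))
      fun h k => h _ (hle.trans (Nat.le_add_right _ _))

theorem exists_shape_strictMono {J : Type*} [LinearOrder J] [Infinite J] (s : Finset J) :
    ∃ (d : Bool) (g h : ℕ) (f : Shape d g h → J), StrictMono f ∧ ∀ x ∈ s, x ∈ Set.range f := by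
  classical
  obtain ⟨d, f, hf, hs⟩ := exists_ray_strictMono s
  let lo := s.filter fun x => ∀ k, x < f k
  let hi := s.filter fun x => ∀ k, f k < x
  refine ⟨d, lo.card, hi.card, fun z => Sum.elim (lo.orderEmbOfFin rfl)
    (fun y => Sum.elim f (hi.orderEmbOfFin rfl) (ofLex y)) (ofLex z), ?_, ?_⟩
  · have hlo : ∀ i k, lo.orderEmbOfFin rfl i < f k := fun i =>
      (Finset.mem_filter.1 (Finset.orderEmbOfFin_mem lo rfl i)).2
    have hhi : ∀ i k, f k < hi.orderEmbOfFin rfl i := fun i =>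
      (Finset.mem_filter.1 (Finset.orderEmbOfFin_mem hi rfl i)).2
    have hlohi : ∀ i j, lo.orderEmbOfFin rfl i < hi.orderEmbOfFin rfl j := fun i j =>
      (hlo i (Classical.arbitrary _)).trans (hhi j _)
    intro x y hxy
    obtain ⟨x, rfl⟩ := toLex.surjective x
    obtain ⟨y, rfl⟩ := toLex.surjective y
    rw [Sum.Lex.toLex_lt_toLex] at hxy
    cases hxy with
    | inl h => exact (lo.orderEmbOfFin rfl).strictMono h
    | @inr x y h =>
      obtain ⟨x, rfl⟩ := toLex.surjective x
      obtain ⟨y, rfl⟩ := toLex.surjective y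
      rw [Sum.Lex.toLex_lt_toLex] at h
      cases h with
      | inl h => exact hf h
      | inr h => exact (hi.orderEmbOfFin rfl).strictMono h
      | sep x y => exact hhi _ _
    | sep x y =>
      obtain ⟨y, rfl⟩ := toLex.surjective y
      cases y
      · exact hlo _ _
      · exact hlohi _ _
  · intro x hx
    obtain h | h := hs x hx
    · have : x ∈ Set.range (lo.orderEmbOfFin rfl) := by
        rw [Finset.range_orderEmbOfFin]
        exact Finset.mem_coe.2 (Finset.mem_filter.2 ⟨hx, h⟩)
      obtain ⟨i, hi⟩ := this
      exact ⟨toLex (Sum.inl i), hi⟩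
    · have : x ∈ Set.range (hi.orderEmbOfFin rfl) := by
        rw [Finset.range_orderEmbOfFin]
        exact Finset.mem_coe.2 (Finset.mem_filter.2 ⟨hx, h⟩)
      obtain ⟨i, hi⟩ := this
      exact ⟨toLex (Sum.inr (toLex (Sum.inr i))), hi⟩

/-! ### Patterns -/

variable (L) in
/-- The isomorphism type of a failure of indiscernibility over an `n`-tuple: the index order, given
by a direction and the numbers of points below and above the ray, a formula `φ(x; y₁, …, y_len)`,
and two increasing tuples of indices, at which `φ` is to hold and to fail, respectively.

Each `yᵢ` is an infinite tuple indexed by `ℕ`, so that the number of relevant coordinates need not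
be recorded. -/
structure Pattern (n : ℕ) where
  dir : Bool
  lo : ℕ
  hi : ℕ
  len : ℕ
  formula : L.Formula (Fin n ⊕ Fin len × ℕ)
  pos : Fin len ↪o Shape dir lo hi
  neg : Fin len ↪o Shape dir lo hi

/-- The index order of the sequences that show the pattern `P`. -/
abbrev Pattern.Index {n : ℕ} (P : Pattern L n) : Type := Shape P.dir P.lo P.hi

theorem mk_formula_le {α : Type} [Countable α] : #(L.Formula α) ≤ cardT L := by
  have h : #(L.Formula α) ≤ #(Σ k, L.BoundedFormula α k) :=
    mk_le_of_injective (f := fun φ => ⟨0, φ⟩) fun φ ψ h => by simpa using h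
  refine h.trans (BoundedFormula.card_le.trans (max_le (le_max_left _ _) ?_))
  refine (add_le_max _ _).trans (max_le (max_le ?_ ?_) (le_max_left _ _))
  · exact (lift_le_aleph0.2 (mk_le_aleph0 (α := α))).trans (le_max_left _ _)
  · rw [lift_id']
    exact le_max_right _ _

theorem mk_pattern_le (n : ℕ) : #(Pattern L n) ≤ cardT L := by
  let S (c : Bool × ℕ × ℕ × ℕ) : Type := Fin c.2.2.2 ↪o Shape c.1 c.2.1 c.2.2.1
  let X (c : Bool × ℕ × ℕ × ℕ) : Type (max u v) :=
    L.Formula (Fin n ⊕ Fin c.2.2.2 × ℕ) × S c × S c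
  let F : Pattern L n → Σ c, X c := fun P => ⟨(P.dir, P.lo, P.hi, P.len), P.formula, P.pos, P.neg⟩
  have hF : Function.Injective F := by
    rintro ⟨d, g, h, m, φ, σ, ρ⟩ ⟨d', g', h', m', φ', σ', ρ'⟩ hPQ
    simp only [F, Sigma.mk.injEq, Prod.mk.injEq] at hPQ
    obtain ⟨⟨rfl, rfl, rfl, rfl⟩, hPQ⟩ := hPQ
    cases hPQ
    rfl
  have haleph : (ℵ₀ : Cardinal.{max u v}) ≤ cardT L := le_max_left _ _
  have hX : ∀ c, #(X c) ≤ cardT L := by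
    intro c
    have hS : Countable (S c) := DFunLike.coe_injective.countable
    simp only [X, mk_prod, lift_id, lift_uzero]
    refine mul_le_of_le haleph mk_formula_le ?_
    refine (lift_le_aleph0.2 ?_).trans haleph
    exact mul_le_of_le le_rfl mk_le_aleph0 mk_le_aleph0
  have hsum := sum_le_lift_mk_mul_iSup fun c => #(X c)
  refine (mk_le_of_injective hF).trans ?_
  rw [mk_sigma]
  refine hsum.trans (mul_le_of_le haleph ?_ (ciSup_le' hX))
  exact (lift_le_aleph0.2 mk_le_aleph0).trans haleph

/-- The parameters over which the `k`-th of the sequences `I` is required to be indiscernible. -/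
def otherParams {K Z β : Type*} (A : Set C) (I : K → Z → β → C) (k : K) :
    A ⊕ {q : K × Z × β // q.1 ≠ k} → C :=
  Sum.elim (↑) fun q => I q.1.1 q.1.2.1 q.1.2.2

/-- The sequences `I k` are mutually indiscernible over `A`, and each of them shows, together with
the realization `a` of `p`, the pattern `P`. -/
structure IsPattern {A : Set C} {n : ℕ} (p : PartialType L A n) (P : Pattern L n) {K : Type*}
    (I : K → P.Index → ℕ → C) (a : Fin n → C) : Prop where
  realizes : Realizes a p
  indiscOver : ∀ k, IndiscOver L (otherParams A I k) (I k)
  realize_pos : ∀ k, P.formula.Realize (Sum.elim a fun z => I k (P.pos z.1) z.2)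
  not_realize_neg : ∀ k, ¬ P.formula.Realize (Sum.elim a fun z => I k (P.neg z.1) z.2)

/-! ### Compactness for patterns -/

/-- If `P` is shown by infinitely many sequences over the restrictions of `p` to sets containing any
given finite subset of `A`, then it is shown over `A` itself by any small number of sequences. -/
theorem exists_isPattern [Nonempty C] {κ : Cardinal.{w}} (hκ : ℵ₀ < κ)
    (hsat : IsSaturated L C κ) {A : Set C} (hA : #A < κ) {n : ℕ} (p : PartialType L A n)
    (P : Pattern L n)
    (H : ∀ A₀ : Finset A, ∃ (B : Set C) (hB : B ⊆ A), (∀ x ∈ A₀, (x : C) ∈ B) ∧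
      ∃ (I : ℕ → P.Index → ℕ → C) (a : Fin n → C), IsPattern (p.restrict hB) P I a)
    (K : Type w) (hK : #K < κ) :
    ∃ (I : K → P.Index → ℕ → C) (a : Fin n → C), IsPattern p P I a := by
  classical
  let U : Type w := A ⊕ ((K × P.Index × ℕ) ⊕ Fin n)
  have hU : #U < κ := by
    simp only [U, mk_sum, mk_prod, lift_id, lift_uzero]
    refine add_lt_of_lt hκ.le hA (add_lt_of_lt hκ.le (mul_lt_of_lt hκ.le hK ?_) ?_)
    · refine lt_of_le_of_lt (lift_le_aleph0.2 ?_) hκ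
      exact mul_le_of_le le_rfl mk_le_aleph0 mk_le_aleph0
    · exact lt_of_le_of_lt (lift_le_aleph0.2 mk_le_aleph0) hκ
  let val (I : K → P.Index → ℕ → C) (a : Fin n → C) : U → C :=
    Sum.elim (↑) (Sum.elim (fun q => I q.1 q.2.1 q.2.2) a)
  -- The type to be realized is taken as large as possible: it consists of all formulas that hold,
  -- for finite `A₀` and `K₀` depending on the formula, in every countable family showing `P` over a
  -- set containing `A₀`, if its members are assigned injectively to the indices in `K₀`.
  let Γ : Set (L.Formula U) := {θ | ∃ (A₀ : Finset A) (K₀ : Finset K),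
    ∀ (B : Set C) (hB : B ⊆ A), (∀ x ∈ A₀, (x : C) ∈ B) →
      ∀ j : K → ℕ, Set.InjOn j (K₀ : Set K) →
        ∀ (I : ℕ → P.Index → ℕ → C) (a : Fin n → C), IsPattern (p.restrict hB) P I a →
          θ.Realize (val (I ∘ j) a)}
  obtain ⟨v, hv, hvΓ⟩ := hsat.exists_realize hU Γ (Set.range Sum.inl)
      (Sum.elim (↑) fun _ => Classical.arbitrary C) (by
    intro Γ₀ hΓ₀
    choose! A₀ K₀ h₀ using hΓ₀
    obtain ⟨B, hB, hAB, I, a, hI⟩ := H (Γ₀.biUnion A₀)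
    obtain ⟨j, hj⟩ := Set.countable_iff_exists_injOn.1 (Γ₀.biUnion K₀).countable_toSet
    refine ⟨val (I ∘ j) a, ?_, fun θ hθ => ?_⟩
    · rintro _ ⟨x, rfl⟩
      rfl
    · refine h₀ hθ B hB (fun x hx => hAB x (Finset.mem_biUnion.2 ⟨θ, hθ, hx⟩)) j
        (hj.mono fun k hk => ?_) I a hI
      exact Finset.mem_coe.2 (Finset.mem_biUnion.2 ⟨θ, hθ, hk⟩))
  let I : K → P.Index → ℕ → C := fun k z b => v (Sum.inr (Sum.inl (k, z, b)))
  let a : Fin n → C := fun i => v (Sum.inr (Sum.inr i))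
  have hvA : ∀ x : A, v (Sum.inl x) = x := fun x => hv _ ⟨x, rfl⟩
  have hval : v = val I a := by
    funext x
    obtain x | ⟨k, z, b⟩ | i := x
    · exact hvA x
    · rfl
    · rfl
  rw [hval] at hvΓ
  refine ⟨I, a, ⟨fun φ hφ => ?_, fun k => ?_, fun k => ?_, fun k => ?_⟩⟩
  · have hvalx : ∀ (I : K → P.Index → ℕ → C) (a : Fin n → C),
        val I a ∘ Sum.map id Sum.inr = Sum.elim Subtype.val a := by
      intro I a
      funext x
      obtain x | i := x <;> rfl
    have hmem : Formula.relabel (Sum.map id Sum.inr)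
        (BoundedFormula.constantsVarsEquiv φ : L.Formula (A ⊕ Fin n)) ∈ Γ := by
      obtain ⟨s, hs⟩ := exists_finset_onBoundedFormula_eq φ
      refine ⟨s, ∅, fun B hB hsB j _ I a hI => ?_⟩
      obtain ⟨φ', rfl⟩ := hs B hB hsB
      have h := hI.realizes φ' hφ
      have h' := ((L.lhomWithConstantsMap (Set.inclusion hB)).realize_onFormula φ').2 h
      rw [Formula.realize_relabel]
      rw [hvalx]
      exact (realize_constantsVarsEquiv_formula _ _).2 h'
    have h := hvΓ _ hmem
    rw [Formula.realize_relabel, hvalx] at h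
    exact (realize_constantsVarsEquiv_formula _ _).1 h
  · refine IndiscOver.of_finset fun t m ψ s r hs hr => ?_
    let g (s : Fin m → P.Index) : t ⊕ Fin m × ℕ → U :=
      Sum.elim (fun w => Sum.map id (fun q => Sum.inl q.1) w.1)
        fun z => Sum.inr (Sum.inl (k, s z.1, z.2))
    have hg : ∀ (s : Fin m → P.Index) (I : K → P.Index → ℕ → C) (a : Fin n → C),
        val I a ∘ g s =
          Sum.elim (fun w : t => otherParams A I k w) fun z => I k (s z.1) z.2 := by
      intro s I a
      funext x
      obtain ⟨x | q, hx⟩ | z := x <;> rfl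
    have hmem : (ψ.relabel (g s)).iff (ψ.relabel (g r)) ∈ Γ := by
      refine ⟨t.toLeft, insert k (t.toRight.image fun q => q.1.1),
        fun B hB hsB j hj I a hI => ?_⟩
      rw [Formula.realize_iff, Formula.realize_relabel, Formula.realize_relabel, hg, hg]
      refine (hI.indiscOver (j k)).of_forall_exists_eq ?_ m ψ s r hs hr
      rintro ⟨x | q, hx⟩
      · exact ⟨Sum.inl ⟨x, hsB x (Finset.mem_toLeft.2 hx)⟩, rfl⟩
      · refine ⟨Sum.inr ⟨(j q.1.1, q.1.2.1, q.1.2.2), fun h => q.2 (hj ?_ ?_ h)⟩, rfl⟩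
        · exact Finset.mem_coe.2 (Finset.mem_insert_of_mem
            (Finset.mem_image.2 ⟨q, Finset.mem_toRight.2 hx, rfl⟩))
        · exact Finset.mem_coe.2 (Finset.mem_insert_self _ _)
    have h := hvΓ _ hmem
    rwa [Formula.realize_iff, Formula.realize_relabel, Formula.realize_relabel, hg, hg] at h
  · have hmem : P.formula.relabel (Sum.elim (fun i => Sum.inr (Sum.inr i))
        fun z => Sum.inr (Sum.inl (k, P.pos z.1, z.2))) ∈ Γ := by
      refine ⟨∅, ∅, fun B hB hsB j hj I a hI => ?_⟩
      rw [Formula.realize_relabel]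
      convert hI.realize_pos (j k) using 1
      funext x
      obtain i | z := x <;> rfl
    have h := hvΓ _ hmem
    rw [Formula.realize_relabel] at h
    convert h using 1
    funext x
    obtain i | z := x <;> rfl
  · have hmem : (P.formula.relabel (Sum.elim (fun i => Sum.inr (Sum.inr i))
        fun z => Sum.inr (Sum.inl (k, P.neg z.1, z.2)))).not ∈ Γ := by
      refine ⟨∅, ∅, fun B hB hsB j hj I a hI => ?_⟩
      rw [Formula.realize_not, Formula.realize_relabel]
      convert hI.not_realize_neg (j k) using 2
      funext x
      obtain i | z := x <;> rfl
    have h := hvΓ _ hmem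
    rw [Formula.realize_not, Formula.realize_relabel] at h
    convert h using 2
    funext x
    obtain i | z := x <;> rfl

/-! ### Patterns and the dp-rank -/

/-- A sequence that is not indiscernible over `A ∪ a` shows a pattern, after its index order has
been shrunk along `F` and each tuple replaced by the elements of `A` and the coordinates that `t`
lists. -/
theorem exists_pattern_of_not_indiscernible {A : Set C} {n : ℕ} {a : Fin n → C} {J β : Type w}
    [LinearOrder J] [Infinite J] {I : J → β → C}
    (hI : ¬ Indiscernible L (A ∪ Set.range a) I) :
    ∃ (P : Pattern L n) (F : P.Index → J) (t : ℕ → A ⊕ β), StrictMono F ∧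
      P.formula.Realize
        (Sum.elim a fun z => Sum.elim ((↑) : A → C) (I (F (P.pos z.1))) (t z.2)) ∧
      ¬ P.formula.Realize
        (Sum.elim a fun z => Sum.elim ((↑) : A → C) (I (F (P.neg z.1))) (t z.2)) := by
  classical
  let e : A ⊕ Fin n → C := Sum.elim (↑) a
  have he : ¬ IndiscOver L e I := by
    refine fun h => hI (indiscernible_iff_indiscOver.2 (h.of_forall_exists_eq ?_))
    rintro ⟨_, hx | ⟨i, rfl⟩⟩
    · exact ⟨Sum.inl ⟨_, hx⟩, rfl⟩
    · exact ⟨Sum.inr i, rfl⟩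
  obtain ⟨m, φ, s, r, hs, hr, h₁, h₂⟩ : ∃ (m : ℕ) (φ : L.Formula ((A ⊕ Fin n) ⊕ Fin m × β))
      (s r : Fin m → J), StrictMono s ∧ StrictMono r ∧
        φ.Realize (Sum.elim e fun z => I (s z.1) z.2) ∧
        ¬ φ.Realize (Sum.elim e fun z => I (r z.1) z.2) := by
    simp only [IndiscOver, not_forall] at he
    obtain ⟨m, φ, s, r, hs, hr, h⟩ := he
    by_cases h' : φ.Realize (Sum.elim e fun z => I (s z.1) z.2)
    · exact ⟨m, φ, s, r, hs, hr, h', fun h'' => h ⟨fun _ => h'', fun _ => h'⟩⟩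
    · exact ⟨m, φ, r, s, hr, hs, by tauto, h'⟩
  -- the two tuples differ, so they have at least one entry
  obtain ⟨i₀, b₀⟩ : Nonempty (Fin m × β) := by
    by_contra hne
    rw [not_nonempty_iff] at hne
    exact h₂ (by convert h₁)
  have : Nonempty (A ⊕ β) := ⟨Sum.inr b₀⟩
  obtain ⟨d, g, h, F, hF, hrange⟩ :=
    exists_shape_strictMono (Finset.univ.image s ∪ Finset.univ.image r)
  have hs' : ∀ i, ∃ z, F z = s i := fun i => hrange _ (by simp)
  have hr' : ∀ i, ∃ z, F z = r i := fun i => hrange _ (by simp)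
  choose σ hσ using hs'
  choose ρ hρ using hr'
  have hσm : StrictMono σ := fun x y hxy => hF.lt_iff_lt.1 (by rw [hσ, hσ]; exact hs hxy)
  have hρm : StrictMono ρ := fun x y hxy => hF.lt_iff_lt.1 (by rw [hρ, hρ]; exact hr hxy)
  -- `c` sends a variable to the parameter or coordinate that it stands for, with the junk value
  -- `b₀` at the variables for `a`; `enc` numbers those which occur in `φ`.
  let c : (A ⊕ Fin n) ⊕ Fin m × β → A ⊕ β :=
    Sum.elim (Sum.elim Sum.inl fun _ => Sum.inr b₀) fun z => Sum.inr z.2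
  let S : Set (A ⊕ β) := c '' (φ.freeVarFinset : Set _)
  have hS : S.Countable := (φ.freeVarFinset.finite_toSet.image c).countable
  obtain ⟨enc, henc⟩ := Set.countable_iff_exists_injOn.1 hS
  let t : ℕ → A ⊕ β := Function.invFunOn enc S
  have ht : ∀ x ∈ φ.freeVarFinset, t (enc (c x)) = c x := fun x hx =>
    henc.leftInvOn_invFunOn ⟨x, hx, rfl⟩
  -- The tuples are to contain the parameters from `A` as constant coordinates, so that any
  -- position, for instance `i₀`, may be used to refer to them.
  let f : (A ⊕ Fin n) ⊕ Fin m × β → Fin n ⊕ Fin m × ℕ :=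
    Sum.elim (Sum.elim (fun x => Sum.inr (i₀, enc (Sum.inl x))) Sum.inl)
      fun z => Sum.inr (z.1, enc (Sum.inr z.2))
  have key : ∀ q : Fin m → Shape d g h,
      Formula.Realize (BoundedFormula.restrictFreeVar φ fun x => f x)
        (Sum.elim a fun z => Sum.elim ((↑) : A → C) (I (F (q z.1))) (t z.2)) ↔
      φ.Realize (Sum.elim e fun z => I (F (q z.1)) z.2) := by
    refine fun q => BoundedFormula.realize_restrictFreeVar _ ?_
    rintro ⟨(x | i) | z, hx⟩
    · have := ht _ hx
      simp only [c, Sum.elim_inl] at this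
      simp [f, this, e]
    · rfl
    · have := ht _ hx
      simp only [c, Sum.elim_inr] at this
      simp [f, this]
  refine ⟨⟨d, g, h, m, BoundedFormula.restrictFreeVar φ fun x => f x,
    OrderEmbedding.ofStrictMono σ hσm, OrderEmbedding.ofStrictMono ρ hρm⟩, F, t, hF, ?_, ?_⟩
  · refine (key σ).2 ?_
    simpa only [hσ] using h₁
  · refine fun h => h₂ ?_
    simpa only [hρ] using (key ρ).1 h

/-- By the pigeonhole principle, infinitely many of `|T|⁺` sequences show the same pattern. -/
theorem exists_isPattern_of_not_dpRankLT {A : Set C} {n : ℕ} {p : PartialType L A n}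
    (hp : ¬ DpRankLT p (Order.succ (cardT L))) :
    ∃ (P : Pattern L n) (I : ℕ → P.Index → ℕ → C) (a : Fin n → C), IsPattern p P I a := by
  simp only [DpRankLT, not_forall, not_exists] at hp
  obtain ⟨a, ha, ι, J, β, _, _, I, hι, hmut, hind⟩ := hp
  choose P F t hF hpos hneg using fun i => exists_pattern_of_not_indiscernible (hind i)
  have hlt : #(Pattern L n) < #ι := hι ▸ Order.lt_succ_of_le (mk_pattern_le n)
  have : Infinite ι :=
    infinite_iff.2 (hι ▸ (le_max_left _ _).trans (Order.le_succ (cardT L)))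
  obtain ⟨Q, hQ⟩ := exists_infinite_fiber P hlt
  have hfib : ∀ i, P i = Q → ∃ (F : Q.Index → J i) (t : ℕ → A ⊕ β i), StrictMono F ∧
      Q.formula.Realize
        (Sum.elim a fun z => Sum.elim ((↑) : A → C) (I i (F (Q.pos z.1))) (t z.2)) ∧
      ¬ Q.formula.Realize
        (Sum.elim a fun z => Sum.elim ((↑) : A → C) (I i (F (Q.neg z.1))) (t z.2)) := by
    rintro i rfl
    exact ⟨F i, t i, hF i, hpos i, hneg i⟩
  let j : ℕ ↪ P ⁻¹' {Q} := Infinite.natEmbedding _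
  choose G c hG hGpos hGneg using fun k => hfib (j k) (j k).2
  refine ⟨Q, fun k z b => Sum.elim (↑) (I (j k) (G k z)) (c k b), a, ha, fun k => ?_, hGpos, hGneg⟩
  let e : A ⊕ {q : Σ i, J i × β i // q.1 ≠ j k} → C :=
    Sum.elim (↑) fun q => I q.1.1 q.1.2.1 q.1.2.2
  have he : IndiscOver L e (I (j k)) := by
    refine (indiscernible_iff_indiscOver.1 (hmut (j k))).of_forall_exists_eq ?_
    rintro (x | ⟨⟨i, z, b⟩, hi⟩)
    · exact ⟨⟨x, Or.inl x.2⟩, rfl⟩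
    · exact ⟨⟨I i z b, Or.inr (Set.mem_biUnion (x := i) hi ⟨z, b, rfl⟩)⟩, rfl⟩
  have hre : IndiscOver L e fun z b => Sum.elim ((↑) : A → C) (I (j k) (G k z)) (c k b) := by
    convert he.reindex (hG k) fun b => (c k b).map Sum.inl id using 1
    funext z b
    cases c k b <;> rfl
  refine hre.of_forall_exists_eq ?_
  rintro (x | ⟨⟨k', z, b⟩, hk⟩)
  · exact ⟨Sum.inl x, rfl⟩
  · have hne : (j k' : ι) ≠ j k := fun h => hk (j.injective (Subtype.ext h))
    simp only [otherParams, Sum.elim_inr]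
    cases c k' b with
    | inl x => exact ⟨Sum.inl x, rfl⟩
    | inr b' => exact ⟨Sum.inr ⟨⟨j k', G k' z, b'⟩, hne⟩, rfl⟩

theorem IsPattern.not_dpRankLT {A : Set C} {n : ℕ} {p : PartialType L A n} {P : Pattern L n}
    {K : Type w} {I : K → P.Index → ℕ → C} {a : Fin n → C} (h : IsPattern p P I a) :
    ¬ DpRankLT p #K := by
  intro hlt
  obtain ⟨k, hk⟩ := hlt a h.realizes K (fun _ => ULift P.Index) (fun _ => ULift ℕ)
    (fun k z b => I k z.down b.down) rfl (fun k => by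
      refine indiscernible_iff_indiscOver.2 (IndiscOver.of_forall_exists_eq
        ((h.indiscOver k).reindex (F := ULift.down) (fun _ _ hxy => hxy)
          fun b : ULift ℕ => Sum.inr b.down) ?_)
      rintro ⟨x, hx | hx⟩
      · exact ⟨Sum.inl ⟨x, hx⟩, rfl⟩
      · simp only [Set.mem_iUnion] at hx
        obtain ⟨k', hk', z, b, rfl⟩ := hx
        exact ⟨Sum.inr ⟨(k', z.down, b.down), hk'⟩, rfl⟩)
  have ha : IndiscOver L a fun (z : ULift P.Index) (b : ULift ℕ) => I k z.down b.down :=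
    (indiscernible_iff_indiscOver.1 hk).of_forall_exists_eq fun i =>
      ⟨⟨a i, Or.inr ⟨i, rfl⟩⟩, rfl⟩
  have h' := ha P.len (P.formula.relabel (Sum.map id (Prod.map id ULift.up)))
    (ULift.up ∘ P.pos) (ULift.up ∘ P.neg) (fun _ _ hxy => P.pos.strictMono hxy)
    (fun _ _ hxy => P.neg.strictMono hxy)
  simp only [Formula.realize_relabel, Sum.elim_comp_map] at h'
  exact h.not_realize_neg k (h'.1 (h.realize_pos k))

/-- The meaning of `dp-rk(p) < μ` does not depend on the universe of the cardinal `μ`. -/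
theorem DpRankLT.of_lift_eq {A : Set C} {n : ℕ} {p : PartialType L A n} {μ : Cardinal.{t}}
    {ν : Cardinal.{s}} (h : DpRankLT p μ) (hμν : lift.{s} μ = lift.{t} ν) : DpRankLT p ν := by
  intro a ha ι J β _ _ I hι hmut
  obtain ⟨f⟩ : Nonempty (μ.out ≃ ι) := by
    rw [← lift_mk_eq', mk_out, hμν, hι]
  obtain ⟨i, hi⟩ := h a ha μ.out (fun i => J (f i)) (fun i => β (f i)) (fun i => I (f i))
    (mk_out μ) fun i => by
      refine indiscernible_iff_indiscOver.2
        ((indiscernible_iff_indiscOver.1 (hmut (f i))).of_forall_exists_eq ?_)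
      rintro ⟨x, hx | hx⟩
      · exact ⟨⟨x, Or.inl hx⟩, rfl⟩
      · simp only [Set.mem_iUnion] at hx
        obtain ⟨k, hk, hx⟩ := hx
        exact ⟨⟨x, Or.inr (Set.mem_biUnion (x := f k) (fun h => hk (f.injective h)) hx)⟩, rfl⟩
  exact ⟨f i, hi⟩

theorem IsPattern.restrict {A : Set C} {n : ℕ} {p : PartialType L A n} {P : Pattern L n}
    {K : Type*} {I : K → P.Index → ℕ → C} {a : Fin n → C} (h : IsPattern p P I a) {B : Set C}
    (hB : B ⊆ A) : IsPattern (p.restrict hB) P I a where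
  realizes φ hφ :=
    ((L.lhomWithConstantsMap (Set.inclusion hB)).realize_onFormula φ).1 (h.realizes _ hφ)
  indiscOver k := (h.indiscOver k).of_forall_exists_eq (by
    rintro (x | q)
    · exact ⟨Sum.inl ⟨x, hB x.2⟩, rfl⟩
    · exact ⟨Sum.inr q, rfl⟩)
  realize_pos := h.realize_pos
  not_realize_neg := h.not_realize_neg

/-- One pattern, occurring over the restrictions of `p` to large enough subsets of `A`, makes `p`
independent. -/
theorem isIndependent_of_isPattern [Nonempty C] {κ : Cardinal.{w}} (hκ : ℵ₀ < κ)
    (hsat : IsSaturated L C κ) {A : Set C} (hA : #A < κ) {n : ℕ} {p : PartialType L A n}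
    (P : Pattern L n)
    (H : ∀ A₀ : Finset A, ∃ (B : Set C) (hB : B ⊆ A), (∀ x ∈ A₀, (x : C) ∈ B) ∧
      ∃ (I : ℕ → P.Index → ℕ → C) (a : Fin n → C), IsPattern (p.restrict hB) P I a) :
    IsIndependent κ p := by
  intro μ hμ
  obtain ⟨I, a, h⟩ := exists_isPattern hκ hsat hA p P H μ.out (by rwa [mk_out])
  exact mk_out μ ▸ h.not_dpRankLT

theorem IsIndependent.not_dpRankLT_of_lift_lt {κ : Cardinal.{w}} {A : Set C} {n : ℕ}
    {p : PartialType L A n} (hp : IsIndependent κ p) {μ : Cardinal.{t}}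
    (hμ : lift.{w} μ < lift.{t} κ) : ¬ DpRankLT p μ := by
  obtain ⟨ν, hν⟩ := mem_range_lift_of_le hμ.le
  exact fun h => hp ν (lift_lt.1 (hν.trans_lt hμ)) (h.of_lift_eq hν.symm)

end DpRank

theorem mainTheorem8 {L : FirstOrder.Language.{u, v}} (T : L.Theory) (hT : T.IsComplete)
    {C : Type w} [L.Structure C] [Nonempty C] (hC : C ⊨ T)
    (κ : Cardinal.{w})
    (hκ : Cardinal.lift.{w} (Order.succ (DpRank.cardT L)) < Cardinal.lift.{max u v} κ)
    (hsat : DpRank.IsSaturated L C κ)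
    (A : Set C) (hA : #A < κ) (n : ℕ) (p : DpRank.PartialType L A n)
    (hp : DpRank.IsConsistent p) :
    (DpRank.IsDependent κ p →
      ∃ (B : Set C) (hB : B ⊆ A),
        Cardinal.lift.{max u v} #B ≤ Cardinal.lift.{w} (DpRank.cardT L) ∧
        DpRank.IsDependent κ (p.restrict hB)) ∧
    (DpRank.IsIndependent κ p ↔ DpRank.DpRankGE p (Order.succ (DpRank.cardT L))) := by
  have hκ₀ : ℵ₀ < κ := by
    rw [← lift_lt.{w, max u v}, lift_aleph0]
    refine lt_of_le_of_lt ?_ hκ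
    rw [aleph0_le_lift]
    exact (le_max_left _ _).trans (Order.le_succ (DpRank.cardT L))
  refine ⟨fun hdep => ?_, fun h => h.not_dpRankLT_of_lift_lt hκ, fun h => ?_⟩
  · have hfin : ∀ P : DpRank.Pattern L n, ∃ A₀ : Finset A, ∀ (B : Set C) (hB : B ⊆ A),
        (∀ x ∈ A₀, (x : C) ∈ B) → ∀ (I : ℕ → P.Index → ℕ → C) (a : Fin n → C),
          ¬ DpRank.IsPattern (p.restrict hB) P I a := by
      intro P
      by_contra! H
      obtain ⟨μ, hμ, hlt⟩ := hdep
      exact DpRank.isIndependent_of_isPattern hκ₀ hsat hA P H μ hμ hlt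
    choose A₀ hA₀ using hfin
    let B₀ : Set A := ⋃ P, (A₀ P : Set A)
    let B : Set C := (↑) '' B₀
    have hB : B ⊆ A := Subtype.coe_image_subset A B₀
    refine ⟨B, hB, ?_, ?_⟩
    · have haleph : ℵ₀ ≤ lift.{w} (DpRank.cardT L) := by
        rw [aleph0_le_lift]
        exact le_max_left _ _
      refine (lift_le.2 mk_image_le).trans ?_
      refine (mk_iUnion_le_lift _).trans ?_
      refine mul_le_of_le haleph (lift_le.2 (DpRank.mk_pattern_le n)) ?_
      refine ciSup_le' fun P => ?_
      exact (lift_le_aleph0.2 mk_le_aleph0).trans haleph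
    · by_contra hind
      have hind : DpRank.IsIndependent κ (p.restrict hB) := fun μ hμ hlt => hind ⟨μ, hμ, hlt⟩
      obtain ⟨P, I, a, h⟩ :=
        DpRank.exists_isPattern_of_not_dpRankLT (hind.not_dpRankLT_of_lift_lt hκ)
      exact hA₀ P B hB (fun x hx => ⟨x, Set.mem_iUnion.2 ⟨P, hx⟩, rfl⟩) I a h
  · obtain ⟨P, I, a, hI⟩ := DpRank.exists_isPattern_of_not_dpRankLT h
    exact DpRank.isIndependent_of_isPattern hκ₀ hsat hA P fun A₀ =>
      ⟨A, subset_rfl, fun x _ => x.2, I, a, hI.restrict subset_rfl⟩
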